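/- Let $A\in\mathbb R^{n\times n}$, $B\in\mathbb R^{n\times m}$, $C\in\mathbb R^{p\times n}$, $D\in\mathbb R^{p\times m}$, $\Phi\in\mathbb R^{r\times n}$, $\Psi\in\mathbb R^{r\times m}$, with spectral radius $\rho(A)<1$ and $D$ of full row rank. A causal linear discrete time invariant system with impulse response $(g_k)_{k\ge 0}$ (real matrices) is identified with its transfer function $G(z)=\sum_{k\ge0}z^kg_k$; write $\|G\|_2=\big(\sum_{k\ge 0}\operatorname{Tr}(g_kg_k^{\mathsf T})\big)^{1/2}$, let $H_2$ be the class of those $G$ analytic in the open unit disc with $\|G\|_2<\infty$, and $H_\infty$ the class of those analytic in the open unit disc with $\sup_{|z|<1}\sigma_{\max}(G(z))<\infty$. Denote by $\left[\begin{array}{c|c}a&b\\\hline c&d\end{array}\right]$ the system with impulse response $g_0=d$, $g_k=ca^{k-1}b$ for $k\ge1$, and put $$F_1=\left[\begin{array}{c|c}A&B\\\hline C&D\end{array}\right],\qquad F_2=\left[\begin{array}{c|c}A&B\\\hline \Phi&\Psi\end{array}\right],\qquad \Delta(E)=F_2-EF_1 .$$ An estimator is a causal linear discrete time invariant system $E$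 with $p$ inputs and $r$ outputs whose transfer function is analytic in the open unit disc; it is admissible if $\Delta(E)\in H_\infty^{r\times m}$. Let $S\in\mathbb R^{m\times m}$ be symmetric positive definite, $L\in\mathbb R^{m\times n}$, and let $P\in\mathbb R^{n\times n}$ be an admissible solution of the Riccati equation $$P=(A+BL)P(A+BL)^{\mathsf T}+BSB^{\mathsf T}-KTK^{\mathsf T},$$ $$T=(C+DL)P(C+DL)^{\mathsf T}+DSD^{\mathsf T},\qquad K=\big((A+BL)P(C+DL)^{\mathsf T}+BSD^{\mathsf T}\big)T^{-1},$$ that is, $P$ is symmetric positive semi-definite and $\rho(A-KC+(B-KD)L)<1$. Let $$M=\big((\Phi+\Psi L)P(C+DL)^{\mathsf T}+\Psi SD^{\mathsf T}\big)T^{-1}$$ and assume $\rho(A-KC)<1$. Then the noise shaping filter $$G_{K,S,L}=\left[\begin{array}{c|c}A-KC+(B-KD)L&(B-KD)\sqrt S\\\hline L&\sqrt S\end{array}\right]$$ belongs to $H_2^{m\times m}$, and the estimator $$E_{K,M}=\left[\begin{array}{c|c}A-KC&K\\\hline \Phi-MC&M\end{array}\right]$$ is mean square optimal against it: $E_{K,M}$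 is admissible, and $\|\Delta(E_{K,M})G_{K,S,L}\|_2\le\|\Delta(E)G_{K,S,L}\|_2$ for every admissible estimator $E$. -/

import Mathlib

open scoped ENNReal

noncomputable section

namespace AnisoFilter

/-! ### Causal linear discrete time invariant systems and Hardy classes -/

/-- A causal LDTI system with `m`-dimensional input and `q`-dimensional output, given by its
real matrix impulse response `g 0, g 1, g 2, …`, so that it maps `w` to
`∑ k ≥ 0, g k * w (j - k)`. -/
abbrev Sys (q m : ℕ) : Type := ℕ → Matrix (Fin q) (Fin m) ℝ

/-- The series connection `G H` (first `H`, then `G`): convolution of the impulse responses,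
that is, the product of the transfer functions. -/
def Sys.comp {q l m : ℕ} (G : Sys q l) (H : Sys l m) : Sys q m :=
  fun k => ∑ i ∈ Finset.range (k + 1), G i * H (k - i)

/-- The `k`-th term `z ^ k g_k` of the transfer function series. -/
def Sys.term {q m : ℕ} (G : Sys q m) (z : ℂ) (k : ℕ) : Matrix (Fin q) (Fin m) ℂ :=
  z ^ k • (G k).map (fun t : ℝ => (t : ℂ))

/-- The transfer function `G(z) = ∑ k ≥ 0, z ^ k g_k`. -/
def Sys.transfer {q m : ℕ} (G : Sys q m) (z : ℂ) : Matrix (Fin q) (Fin m) ℂ :=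
  ∑' k, G.term z k

/-- The transfer function is analytic in the open unit disc: its power series converges at
every point of the disc. -/
def Sys.AnalyticOnDisc {q m : ℕ} (G : Sys q m) : Prop :=
  ∀ z : ℂ, ‖z‖ < 1 → Summable (G.term z)

open scoped Matrix.Norms.L2Operator in
/-- `G` belongs to `H_∞`: the transfer function is analytic in the open unit disc and its largest
singular value (the operator norm for the Euclidean norms) is bounded there. -/
def Sys.IsHInf {q m : ℕ} (G : Sys q m) : Prop :=
  G.AnalyticOnDisc ∧ ∃ c : ℝ, ∀ z : ℂ, ‖z‖ < 1 → ‖G.transfer z‖ ≤ c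

/-- The `H_2`-norm `(∑ k ≥ 0, Tr (g_k g_kᵀ)) ^ (1/2)`, as an element of `[0, ∞]`. -/
def Sys.h2Norm {q m : ℕ} (G : Sys q m) : ℝ≥0∞ :=
  (∑' k, ENNReal.ofReal (G k * (G k).transpose).trace) ^ (1 / 2 : ℝ)

/-- `G` belongs to `H_2`. -/
def Sys.IsH2 {q m : ℕ} (G : Sys q m) : Prop :=
  G.AnalyticOnDisc ∧ G.h2Norm < ∞

/-- The system with the state-space realization `x (k+1) = a x k + b w k`,
`y k = c x k + d w k`. -/
def ofStateSpace {n q m : ℕ} (a : Matrix (Fin n) (Fin n) ℝ) (b : Matrix (Fin n) (Fin m) ℝ)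
    (c : Matrix (Fin q) (Fin n) ℝ) (d : Matrix (Fin q) (Fin m) ℝ) : Sys q m
  | 0 => d
  | k + 1 => c * a ^ k * b

/-- Asymptotic stability of a real matrix: `ρ(a) < 1`, the spectral radius being taken over `ℂ`. -/
def IsStable {n : ℕ} (a : Matrix (Fin n) (Fin n) ℝ) : Prop :=
  spectralRadius ℂ (a.map (fun t : ℝ => (t : ℂ))) < 1

open scoped Matrix.Norms.L2Operator MatrixOrder in
/-- The positive semi-definite square root of a positive semi-definite real matrix. -/
def matSqrt {m : ℕ} (S : Matrix (Fin m) (Fin m) ℝ) : Matrix (Fin m) (Fin m) ℝ :=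
  CFC.sqrt S

/-! ### The filtering problem -/

/-- The matrices of the system `x (k+1) = A x k + B w k`, `y k = C x k + D w k`,
`z k = Φ x k + Ψ w k` with `n`-dimensional state, `m`-dimensional disturbance,
`p`-dimensional observation `y` and `r`-dimensional signal `z` to be estimated. -/
structure Plant (n m p r : ℕ) where
  A : Matrix (Fin n) (Fin n) ℝ
  B : Matrix (Fin n) (Fin m) ℝ
  C : Matrix (Fin p) (Fin n) ℝ
  D : Matrix (Fin p) (Fin m) ℝ
  Φ : Matrix (Fin r) (Fin n) ℝ
  Ψ : Matrix (Fin r) (Fin m) ℝ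

namespace Plant

variable {n m p r : ℕ} (F : Plant n m p r)

/-- The subsystem from `w` to `y`. -/
def F₁ : Sys p m := ofStateSpace F.A F.B F.C F.D

/-- The subsystem from `w` to `z`. -/
def F₂ : Sys r m := ofStateSpace F.A F.B F.Φ F.Ψ

/-- The error operator `Δ(E) = F₂ - E F₁` of an estimator `E`. -/
def errorOp (E : Sys r p) : Sys r m := F.F₂ - E.comp F.F₁

/-- Admissible estimators: causal LDTI systems, with transfer function analytic in the open unit
disc, whose error operator belongs to `H_∞`. Nothing else is required of `E`; in particular its
transfer function need be neither bounded nor rational. -/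
def IsAdmissibleEstimator (E : Sys r p) : Prop :=
  E.AnalyticOnDisc ∧ (F.errorOp E).IsHInf

/-- `E` is mean square optimal against the noise shaping filter `G ∈ H_2`: it minimizes the
`H_2`-norm of `Δ(E) G` over all admissible estimators. -/
def IsMeanSquareOptimal (E : Sys r p) (G : Sys m m) : Prop :=
  F.IsAdmissibleEstimator E ∧
    ∀ E' : Sys r p, F.IsAdmissibleEstimator E' →
      ((F.errorOp E).comp G).h2Norm ≤ ((F.errorOp E').comp G).h2Norm

/-- The set of gains `K` with `A - K C` asymptotically stable. -/
def stabGains : Set (Matrix (Fin n) (Fin p) ℝ) :=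
  {K | IsStable (F.A - K * F.C)}

/-- The set of `L` with `A - K C + (B - K D) L` asymptotically stable. -/
def shapingGains (K : Matrix (Fin n) (Fin p) ℝ) : Set (Matrix (Fin m) (Fin n) ℝ) :=
  {L | IsStable (F.A - K * F.C + (F.B - K * F.D) * L)}

/-- The estimator with the structure of a steady-state Kalman filter with gains `K`, `M`. -/
def estimator (K : Matrix (Fin n) (Fin p) ℝ) (M : Matrix (Fin r) (Fin p) ℝ) : Sys r p :=
  ofStateSpace (F.A - K * F.C) K (F.Φ - M * F.C) M

/-- The noise shaping filter parameterized by `K`, `S`, `L`. -/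
def shapingFilter (K : Matrix (Fin n) (Fin p) ℝ) (S : Matrix (Fin m) (Fin m) ℝ)
    (L : Matrix (Fin m) (Fin n) ℝ) : Sys m m :=
  ofStateSpace (F.A - K * F.C + (F.B - K * F.D) * L) ((F.B - K * F.D) * matSqrt S) L (matSqrt S)

/-! ### The filtering Riccati equation -/

variable (S : Matrix (Fin m) (Fin m) ℝ) (L : Matrix (Fin m) (Fin n) ℝ)
  (P : Matrix (Fin n) (Fin n) ℝ)

/-- `T = (C + D L) P (C + D L)ᵀ + D S Dᵀ`. -/
def riccatiT : Matrix (Fin p) (Fin p) ℝ :=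
  (F.C + F.D * L) * P * (F.C + F.D * L).transpose + F.D * S * F.D.transpose

/-- `K = ((A + B L) P (C + D L)ᵀ + B S Dᵀ) T⁻¹`. -/
def riccatiK : Matrix (Fin n) (Fin p) ℝ :=
  ((F.A + F.B * L) * P * (F.C + F.D * L).transpose + F.B * S * F.D.transpose) *
    (F.riccatiT S L P)⁻¹

/-- `M = ((Φ + Ψ L) P (C + D L)ᵀ + Ψ S Dᵀ) T⁻¹`. -/
def riccatiM : Matrix (Fin r) (Fin p) ℝ :=
  ((F.Φ + F.Ψ * L) * P * (F.C + F.D * L).transpose + F.Ψ * S * F.D.transpose) *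
    (F.riccatiT S L P)⁻¹

/-- The discrete algebraic Riccati equation
`P = (A + B L) P (A + B L)ᵀ + B S Bᵀ - K T Kᵀ`, with `T`, `K` as above. -/
def IsRiccatiSolution : Prop :=
  P = (F.A + F.B * L) * P * (F.A + F.B * L).transpose + F.B * S * F.B.transpose -
    F.riccatiK S L P * F.riccatiT S L P * (F.riccatiK S L P).transpose

/-- Admissible solutions of the Riccati equation: symmetric positive semi-definite ones for which
`A - K C + (B - K D) L` is asymptotically stable. -/
def IsAdmissibleSolution : Prop :=
  P.PosSemidef ∧ F.IsRiccatiSolution S L P ∧ L ∈ F.shapingGains (F.riccatiK S L P)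

end Plant

end AnisoFilter

end

noncomputable section

namespace AnisoFilter

open scoped Matrix.Norms.Frobenius
open Finset Filter Topology

/-! ### Series connections and state-space realizations -/

/-! This is an orthogonal projection argument. Write E for the estimator with gains K, M. Its error
operator has state e, the plant state minus the estimator state, and G is driven by the same noise
and has the same state, so Q = Δ(E)G collapses to a realization of order n. Likewise the observation
of the shaped noise is F₁G = N R, where R is the innovation, with output Ce + Dw, and N is the plant
in innovations form.

For another estimator E' this gives Δ(E')G = Q - X R with X = (E' - E)N causal. It remains to see
that Q is orthogonal to X R, for then Pythagoras gives the inequality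
(`Sys.h2Norm_le_of_orthogonal`). The Riccati equation says that P solves the Lyapunov equation of e,
and the formulas for K and M say that the next state and the error output are uncorrelated with the
current innovation; hence Q is uncorrelated with present and past innovations
(`hasSum_crossCorrelation`).

X need not be bounded. Analyticity makes its coefficients summable against t ^ k for every t < 1,
and the exponential decay of Q supplies this weight (`hasSum_trace_comp_eq_zero`). -/

theorem Sys.comp_assoc {q l m s : ℕ} (G : Sys q l) (H : Sys l m) (J : Sys m s) :
    (G.comp H).comp J = G.comp (H.comp J) := by
  funext k
  simp only [Sys.comp, Matrix.sum_mul, Matrix.mul_sum, Finset.sum_sigma']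
  refine Finset.sum_nbij' (fun x => ⟨x.2, x.1 - x.2⟩) (fun x => ⟨x.1 + x.2, x.1⟩) ?_ ?_ ?_ ?_ ?_
  · rintro ⟨i, j⟩ h
    simp only [mem_sigma, mem_range] at h ⊢
    omega
  · rintro ⟨i, j⟩ h
    simp only [mem_sigma, mem_range] at h ⊢
    omega
  · rintro ⟨i, j⟩ h
    simp only [mem_sigma, mem_range] at h
    simp only [Sigma.mk.injEq, heq_eq_eq, and_true]
    omega
  · rintro ⟨i, j⟩ h
    simp
  · rintro ⟨i, j⟩ h
    simp only [mem_sigma, mem_range] at h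
    simp only
    rw [Matrix.mul_assoc, show k - j - (i - j) = k - i by omega]

theorem Sys.sub_comp {q l m : ℕ} (G G' : Sys q l) (H : Sys l m) :
    (G - G').comp H = G.comp H - G'.comp H := by
  funext k
  simp [Sys.comp, Matrix.sub_mul]

/-- The unit impulse. -/
def impulse (m : ℕ) : Sys m m
  | 0 => 1
  | _ + 1 => 0

/-- The state response of `x (k+1) = a x k + b w k` to the unit impulse. -/
def stateResponse {n m : ℕ} (a : Matrix (Fin n) (Fin n) ℝ) (b : Matrix (Fin n) (Fin m) ℝ) : Sys n m
  | 0 => 0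
  | k + 1 => a ^ k * b

theorem stateResponse_succ {n m : ℕ} (a : Matrix (Fin n) (Fin n) ℝ) (b : Matrix (Fin n) (Fin m) ℝ)
    (k : ℕ) : stateResponse a b (k + 1) = a * stateResponse a b k + b * impulse m k := by
  cases k with
  | zero => simp [stateResponse, impulse]
  | succ k => simp [stateResponse, impulse, pow_succ', Matrix.mul_assoc]

theorem ofStateSpace_apply {n q m : ℕ} (a : Matrix (Fin n) (Fin n) ℝ) (b : Matrix (Fin n) (Fin m) ℝ)
    (c : Matrix (Fin q) (Fin n) ℝ) (d : Matrix (Fin q) (Fin m) ℝ) (k : ℕ) :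
    ofStateSpace a b c d k = c * stateResponse a b k + d * impulse m k := by
  cases k with
  | zero => simp [stateResponse, impulse, ofStateSpace]
  | succ k => simp [stateResponse, impulse, ofStateSpace, Matrix.mul_assoc]

/-- The response of a state-space system is read off from any solution of the state recursion. -/
theorem ofStateSpace_comp {n q m s : ℕ} (a : Matrix (Fin n) (Fin n) ℝ) (b : Matrix (Fin n) (Fin m) ℝ)
    (c : Matrix (Fin q) (Fin n) ℝ) (d : Matrix (Fin q) (Fin m) ℝ) (u : Sys m s) (x : Sys n s)
    (h0 : x 0 = 0) (hx : ∀ k, x (k + 1) = a * x k + b * u k) (k : ℕ) :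
    (ofStateSpace a b c d).comp u k = c * x k + d * u k := by
  -- Variation of constants. The truncated subtraction is harmless, since i < k throughout the sum.
  have hsum : ∀ k, x k = ∑ i ∈ range k, a ^ i * b * u (k - 1 - i) := by
    intro k
    induction k with
    | zero => simp [h0]
    | succ k ih =>
      rw [hx, ih, sum_range_succ', Matrix.mul_sum]
      congr 1
      · refine sum_congr rfl fun i _ => ?_
        rw [pow_succ', show k + 1 - 1 - (i + 1) = k - 1 - i by omega]
        simp only [Matrix.mul_assoc]
      · simp
  rw [Sys.comp, sum_range_succ', hsum k, Matrix.mul_sum]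
  congr 1
  refine sum_congr rfl fun i _ => ?_
  rw [show k - (i + 1) = k - 1 - i by omega]
  simp only [ofStateSpace, Matrix.mul_assoc]

/-! ### Norm estimates -/

theorem frobenius_norm_sq {q m : ℕ} (g : Matrix (Fin q) (Fin m) ℝ) :
    ‖g‖ ^ 2 = (g * g.transpose).trace := by
  rw [Matrix.frobenius_norm_def, ← Real.rpow_natCast, ← Real.rpow_mul (by positivity)]
  norm_num [Matrix.trace, Matrix.mul_apply, sq]

theorem norm_entry_le_frobenius {q m : ℕ} (g : Matrix (Fin q) (Fin m) ℂ) (i : Fin q) (j : Fin m) :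
    ‖g i j‖ ≤ ‖g‖ := by
  have h : ‖g‖ ^ 2 = ∑ i, ∑ j, ‖g i j‖ ^ 2 := by
    rw [Matrix.frobenius_norm_def, ← Real.rpow_natCast, ← Real.rpow_mul (by positivity)]
    norm_num
  refine le_of_sq_le_sq ?_ (norm_nonneg _)
  rw [h]
  calc ‖g i j‖ ^ 2 ≤ ∑ j, ‖g i j‖ ^ 2 :=
        single_le_sum (f := fun j => ‖g i j‖ ^ 2) (fun _ _ => by positivity) (mem_univ j)
    _ ≤ _ := single_le_sum (f := fun i => ∑ j, ‖g i j‖ ^ 2) (fun _ _ => by positivity) (mem_univ i)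

theorem Sys.norm_term {q m : ℕ} (G : Sys q m) (z : ℂ) (k : ℕ) :
    ‖G.term z k‖ = ‖G k‖ * ‖z‖ ^ k := by
  rw [Sys.term, norm_smul, norm_pow, Matrix.frobenius_norm_map_eq _ _ (by simp), mul_comm]

theorem Sys.AnalyticOnDisc.summable_norm {q m : ℕ} {G : Sys q m} (hG : G.AnalyticOnDisc)
    {t : ℝ} (h0 : 0 ≤ t) (h1 : t < 1) : Summable fun k => ‖G k‖ * t ^ k := by
  have hz : ‖(t : ℂ)‖ = t := by simp [abs_of_nonneg h0]
  have h : Summable fun k => ‖G.term t k‖ := summable_norm_iff.2 (hG t (by rwa [hz]))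
  simpa only [Sys.norm_term, hz] using h

theorem Sys.AnalyticOnDisc.sub {q m : ℕ} {G H : Sys q m} (hG : G.AnalyticOnDisc)
    (hH : H.AnalyticOnDisc) : (G - H).AnalyticOnDisc := by
  intro z hz
  have : (G - H).term z = fun k => G.term z k - H.term z k := by
    funext k
    ext i j
    simp [Sys.term, mul_sub]
  rw [this]
  exact (hG z hz).sub (hH z hz)

theorem Sys.analyticOnDisc_of_summable {q m : ℕ} {G : Sys q m} (h : Summable fun k => ‖G k‖) :
    G.AnalyticOnDisc := by
  intro z hz
  refine Summable.of_norm (f := G.term z) (h.of_nonneg_of_le (fun _ => norm_nonneg _) fun k => ?_)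
  rw [Sys.norm_term]
  exact mul_le_of_le_one_right (norm_nonneg _) (pow_le_one₀ (norm_nonneg _) hz.le)

theorem Sys.exists_entry_bound_of_summable {q m : ℕ} {G : Sys q m} (h : Summable fun k => ‖G k‖) :
    ∃ c : ℝ, ∀ z : ℂ, ‖z‖ < 1 → ∀ i j, ‖G.transfer z i j‖ ≤ c := by
  refine ⟨∑' k, ‖G k‖, fun z hz i j => (norm_entry_le_frobenius _ i j).trans ?_⟩
  refine tsum_of_norm_bounded h.hasSum fun k => ?_
  rw [Sys.norm_term]
  exact mul_le_of_le_one_right (norm_nonneg _) (pow_le_one₀ (norm_nonneg _) hz.le)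

/-- The weight t ^ k is multiplicative, so weighted summability passes to Cauchy products. -/
theorem Sys.summable_comp {q l m : ℕ} {G : Sys q l} {H : Sys l m} {t : ℝ} (ht : 0 ≤ t)
    (hG : Summable fun k => ‖G k‖ * t ^ k) (hH : Summable fun k => ‖H k‖ * t ^ k) :
    Summable fun k => ‖G.comp H k‖ * t ^ k := by
  have h := summable_norm_sum_mul_range_of_summable_norm hG.norm hH.norm
  refine h.of_nonneg_of_le (fun k => by positivity) fun k => ?_
  refine le_trans ?_ (Real.le_norm_self _)
  calc ‖G.comp H k‖ * t ^ k ≤ (∑ i ∈ range (k + 1), ‖G i‖ * ‖H (k - i)‖) * t ^ k := by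
        gcongr
        exact (norm_sum_le _ _).trans (sum_le_sum fun i _ => Matrix.frobenius_norm_mul _ _)
    _ = _ := by
        rw [sum_mul]
        refine sum_congr rfl fun i hi => ?_
        rw [← Nat.add_sub_of_le (Nat.le_of_lt_succ (mem_range.1 hi)), Nat.add_sub_cancel_left,
          pow_add]
        ring

/-! ### Stability -/

/-- Gelfand's formula, with b strictly between the spectral radius and 1, bounds all large powers;
the constant absorbs the finitely many others. -/
theorem IsStable.exists_pow_le {n : ℕ} {a : Matrix (Fin n) (Fin n) ℝ} (ha : IsStable a) :
    ∃ b : ℝ, 0 < b ∧ b < 1 ∧ ∃ c : ℝ, 0 ≤ c ∧ ∀ k, ‖a ^ k‖ ≤ c * b ^ k := by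
  obtain ⟨b, hb0, hb1⟩ := ENNReal.lt_iff_exists_nnreal_btwn.1 ha
  have hb1' : b < 1 := by exact_mod_cast hb1
  have hpos : 0 < b := by
    have : (0 : ℝ≥0∞) < b := lt_of_le_of_lt zero_le hb0
    exact_mod_cast this
  have hlim := spectrum.pow_nnnorm_pow_one_div_tendsto_nhds_spectralRadius
    (a.map (fun t : ℝ => (t : ℂ)))
  have hev := hlim.eventually_lt_const hb0
  obtain ⟨N, hN⟩ := eventually_atTop.1 hev
  have hmap : ∀ k, ‖(a.map (fun t : ℝ => (t : ℂ))) ^ k‖ = ‖a ^ k‖ := by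
    intro k
    have h : (a.map (fun t : ℝ => (t : ℂ))) ^ k = (a ^ k).map (fun t : ℝ => (t : ℂ)) :=
      (Matrix.map_pow a Complex.ofRealHom k).symm
    rw [h, Matrix.frobenius_norm_map_eq _ _ (by simp)]
  have hlarge : ∀ k, N + 1 ≤ k → ‖a ^ k‖ ≤ (b : ℝ) ^ k := by
    intro k hk
    have h := (hN k (by omega)).le
    have hk0 : (0 : ℝ) < k := by exact_mod_cast (show 0 < k by omega)
    rw [one_div, ENNReal.rpow_inv_le_iff hk0, ENNReal.rpow_natCast] at h
    have h' : ‖(a.map (fun t : ℝ => (t : ℂ))) ^ k‖₊ ≤ b ^ k := by exact_mod_cast h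
    rw [← hmap]
    exact_mod_cast h'
  refine ⟨b, by exact_mod_cast hpos, by exact_mod_cast hb1',
    1 + ∑ j ∈ range (N + 1), ‖a ^ j‖ / (b : ℝ) ^ j, by positivity, fun k => ?_⟩
  have hbk : (0 : ℝ) < (b : ℝ) ^ k := by positivity
  rcases le_or_gt (N + 1) k with hk | hk
  · refine (hlarge k hk).trans (le_mul_of_one_le_left hbk.le ?_)
    linarith [show 0 ≤ ∑ j ∈ range (N + 1), ‖a ^ j‖ / (b : ℝ) ^ j by positivity]
  · rw [← div_le_iff₀ hbk]
    have := single_le_sum (f := fun j => ‖a ^ j‖ / (b : ℝ) ^ j) (fun _ _ => by positivity)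
      (mem_range.2 hk)
    linarith

theorem exists_ofStateSpace_norm_le {n q m : ℕ} {a : Matrix (Fin n) (Fin n) ℝ} {t c₀ : ℝ}
    (ht : 0 < t) (hc : 0 ≤ c₀) (ha : ∀ k, ‖a ^ k‖ ≤ c₀ * t ^ k) (b : Matrix (Fin n) (Fin m) ℝ)
    (c : Matrix (Fin q) (Fin n) ℝ) (d : Matrix (Fin q) (Fin m) ℝ) :
    ∃ c₁, 0 ≤ c₁ ∧ ∀ k, ‖ofStateSpace a b c d k‖ ≤ c₁ * t ^ k := by
  -- The division by t compensates for the delay: coefficient k + 1 contains only the k-th power of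
  -- a.
  refine ⟨‖d‖ + ‖c‖ * c₀ * ‖b‖ / t, by positivity, fun k => ?_⟩
  cases k with
  | zero =>
    simp only [ofStateSpace, pow_zero, mul_one]
    exact le_add_of_nonneg_right (by positivity)
  | succ k =>
    calc ‖c * a ^ k * b‖ ≤ ‖c‖ * (c₀ * t ^ k) * ‖b‖ := by
          refine (Matrix.frobenius_norm_mul _ _).trans ?_
          gcongr
          exact (Matrix.frobenius_norm_mul _ _).trans (by gcongr; exact ha k)
      _ = ‖c‖ * c₀ * ‖b‖ / t * t ^ (k + 1) := by
          field_simp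
          ring
      _ ≤ _ := by
          gcongr
          exact le_add_of_nonneg_left (norm_nonneg _)

theorem IsStable.summable_ofStateSpace {n q m : ℕ} {a : Matrix (Fin n) (Fin n) ℝ} (ha : IsStable a)
    (b : Matrix (Fin n) (Fin m) ℝ) (c : Matrix (Fin q) (Fin n) ℝ) (d : Matrix (Fin q) (Fin m) ℝ) :
    Summable fun k => ‖ofStateSpace a b c d k‖ := by
  obtain ⟨t, ht0, ht1, c₀, hc₀, h⟩ := ha.exists_pow_le
  obtain ⟨c₁, -, h1⟩ := exists_ofStateSpace_norm_le ht0 hc₀ h b c d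
  exact ((summable_geometric_of_lt_one ht0.le ht1).mul_left c₁).of_nonneg_of_le
    (fun _ => norm_nonneg _) h1

end AnisoFilter

namespace AnisoFilter

open Finset Filter Topology

/-! ### Stable realizations belong to the Hardy classes -/

open scoped Matrix.Norms.L2Operator in
-- Entrywise bounds carry the estimates made in the Frobenius norm over to the operator norm that
-- defines `IsHInf`.
theorem exists_l2_opNorm_le_of_entry_le {q m : ℕ} (c : ℝ) :
    ∃ c' : ℝ, ∀ g : Matrix (Fin q) (Fin m) ℂ, (∀ i j, ‖g i j‖ ≤ c) → ‖g‖ ≤ c' := by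
  refine ⟨∑ i, ∑ j, c * ‖(Matrix.single i j 1 : Matrix (Fin q) (Fin m) ℂ)‖, fun g hg => ?_⟩
  conv_lhs => rw [Matrix.matrix_eq_sum_single g]
  refine (norm_sum_le _ _).trans (sum_le_sum fun i _ => (norm_sum_le _ _).trans
    (sum_le_sum fun j _ => ?_))
  rw [show Matrix.single i j (g i j) = g i j • (Matrix.single i j 1 : Matrix (Fin q) (Fin m) ℂ) by
    simp [Matrix.smul_single], norm_smul]
  gcongr
  exact hg i j

theorem IsStable.isHInf_ofStateSpace {n q m : ℕ} {a : Matrix (Fin n) (Fin n) ℝ} (ha : IsStable a)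
    (b : Matrix (Fin n) (Fin m) ℝ) (c : Matrix (Fin q) (Fin n) ℝ) (d : Matrix (Fin q) (Fin m) ℝ) :
    (ofStateSpace a b c d).IsHInf := by
  have hs := ha.summable_ofStateSpace b c d
  obtain ⟨c₀, hc₀⟩ := Sys.exists_entry_bound_of_summable hs
  obtain ⟨c₁, hc₁⟩ := exists_l2_opNorm_le_of_entry_le (q := q) (m := m) c₀
  exact ⟨Sys.analyticOnDisc_of_summable hs, c₁, fun z hz => hc₁ _ (hc₀ z hz)⟩

open scoped Matrix.Norms.L2Operator MatrixOrder in
theorem matSqrt_mul_transpose {m : ℕ} {S : Matrix (Fin m) (Fin m) ℝ} (hS : S.PosSemidef) :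
    matSqrt S * (matSqrt S).transpose = S := by
  have h : (matSqrt S).transpose = matSqrt S := by
    have := (Matrix.nonneg_iff_posSemidef.1 (CFC.sqrt_nonneg S)).isHermitian.eq
    rwa [Matrix.conjTranspose_eq_transpose_of_trivial] at this
  rw [h]
  exact CFC.sqrt_mul_sqrt_self S (Matrix.nonneg_iff_posSemidef.2 hS)

open scoped Matrix.Norms.Frobenius

theorem Sys.h2Norm_eq {q m : ℕ} (G : Sys q m) :
    G.h2Norm = (∑' k, ENNReal.ofReal (‖G k‖ ^ 2)) ^ (1 / 2 : ℝ) := by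
  simp only [Sys.h2Norm, frobenius_norm_sq]

theorem summable_sq_of_summable_norm {q m : ℕ} {G : Sys q m} (h : Summable fun k => ‖G k‖) :
    Summable fun k => ‖G k‖ ^ 2 := by
  refine Summable.of_norm_bounded_eventually_nat (g := fun k => ‖G k‖) h ?_
  filter_upwards [h.tendsto_atTop_zero.eventually_le_const one_pos] with k hk
  rw [Real.norm_of_nonneg (by positivity), sq]
  exact mul_le_of_le_one_right (norm_nonneg _) hk

theorem IsStable.isH2_ofStateSpace {n q m : ℕ} {a : Matrix (Fin n) (Fin n) ℝ} (ha : IsStable a)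
    (b : Matrix (Fin n) (Fin m) ℝ) (c : Matrix (Fin q) (Fin n) ℝ) (d : Matrix (Fin q) (Fin m) ℝ) :
    (ofStateSpace a b c d).IsH2 := by
  have hs := ha.summable_ofStateSpace b c d
  refine ⟨Sys.analyticOnDisc_of_summable hs, ?_⟩
  rw [Sys.h2Norm_eq, ← ENNReal.ofReal_tsum_of_nonneg (fun _ => by positivity)
    (summable_sq_of_summable_norm hs)]
  exact ENNReal.rpow_lt_top_of_nonneg (by norm_num) ENNReal.ofReal_ne_top

/-! ### Orthogonality in `H_2` -/

/-- Subtracting from `Q` an orthogonal system does not decrease its `H_2`-norm. -/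
theorem Sys.h2Norm_le_of_orthogonal {q m : ℕ} {Q H : Sys q m} (hQ : Summable fun k => ‖Q k‖)
    (horth : HasSum (fun k => (Q k * (H k).transpose).trace) 0) : Q.h2Norm ≤ (Q - H).h2Norm := by
  rw [Sys.h2Norm_eq, Sys.h2Norm_eq]
  refine ENNReal.rpow_le_rpow ?_ (by norm_num)
  -- A competitor of infinite norm is allowed and loses trivially.
  by_cases htop : ∑' k, ENNReal.ofReal (‖(Q - H) k‖ ^ 2) = ⊤
  · rw [htop]
    exact le_top
  have hsum : Summable fun k => ‖(Q - H) k‖ ^ 2 := by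
    refine (ENNReal.summable_toReal htop).congr fun k => ?_
    rw [ENNReal.toReal_ofReal (by positivity)]
  have hQ2 := summable_sq_of_summable_norm hQ
  rw [← ENNReal.ofReal_tsum_of_nonneg (fun _ => by positivity) hQ2,
    ← ENNReal.ofReal_tsum_of_nonneg (fun _ => by positivity) hsum]
  refine ENNReal.ofReal_le_ofReal ?_
  -- Since ‖Q - H‖² = ‖Q‖² - 2⟨Q, H⟩ + ‖H‖², dropping ‖H‖² termwise avoids having to know that H is
  -- square summable.
  have h := hQ2.hasSum.sub (horth.mul_left 2)
  rw [mul_zero, sub_zero] at h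
  refine hasSum_le (fun k => ?_) h hsum.hasSum
  have hH : 0 ≤ (H k * (H k).transpose).trace := by
    rw [← frobenius_norm_sq]
    positivity
  have hcomm : (H k * (Q k).transpose).trace = (Q k * (H k).transpose).trace := by
    rw [← Matrix.trace_transpose, Matrix.transpose_mul, Matrix.transpose_transpose]
  simp only [frobenius_norm_sq, Pi.sub_apply, Matrix.transpose_sub, Matrix.sub_mul, Matrix.mul_sub,
    Matrix.trace_sub, hcomm]
  linarith

/-- If the cross-correlations of `Q` with the past of `R` vanish, then `Q` is orthogonal to every
`X R` with `X` causal. -/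
theorem hasSum_trace_comp_eq_zero {q p m : ℕ} {Q : Sys q m} {R : Sys p m} {X : Sys q p} {t c c' : ℝ}
    (ht0 : 0 < t) (ht1 : t < 1) (hc : 0 ≤ c) (hQ : ∀ k, ‖Q k‖ ≤ c * t ^ k)
    (hR : ∀ k, ‖R k‖ ≤ c' * t ^ k) (hX : Summable fun k => ‖X k‖ * t ^ k)
    (hcorr : ∀ i, HasSum (fun l => Q (i + l) * (R l).transpose) 0) :
    HasSum (fun k => (Q k * (X.comp R k).transpose).trace) 0 := by
  have hc' : 0 ≤ c' := by simpa using (norm_nonneg _).trans (hR 0)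
  -- The inner product as a double series with k = i + l: absolutely summable, it vanishes when
  -- summed over l first, and regrouping along antidiagonals recovers the series in k.
  let f : ℕ × ℕ → Matrix (Fin q) (Fin q) ℝ := fun x =>
    Q (x.1 + x.2) * (R x.2).transpose * (X x.1).transpose
  have hf : Summable f := by
    have hg : Summable fun l : ℕ => c * c' * t ^ l :=
      (summable_geometric_of_lt_one ht0.le ht1).mul_left _
    refine Summable.of_norm_bounded (hX.mul_of_nonneg hg (fun _ => by positivity)
      (fun _ => by positivity)) ?_
    rintro ⟨i, l⟩
    calc ‖f (i, l)‖ ≤ ‖Q (i + l)‖ * ‖R l‖ * ‖X i‖ := by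
          refine (Matrix.frobenius_norm_mul _ _).trans ?_
          rw [Matrix.frobenius_norm_transpose]
          gcongr
          exact (Matrix.frobenius_norm_mul _ _).trans (by rw [Matrix.frobenius_norm_transpose])
      -- The decay of Q alone suffices: t ^ i pays for the growth of X, t ^ l for the sum over l.
      _ ≤ (c * t ^ (i + l)) * (c' * 1) * ‖X i‖ := by
          gcongr
          · exact hQ _
          · exact (hR l).trans (by gcongr; exact pow_le_one₀ ht0.le ht1.le)
      _ = _ := by
          rw [pow_add]
          ring
  have hf0 : HasSum f 0 := by
    have hrow : ∀ i, HasSum (fun l => f (i, l)) 0 := fun i => by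
      have hcont : Continuous fun Y : Matrix (Fin q) (Fin p) ℝ => Y * (X i).transpose := by fun_prop
      have := (hcorr i).map (AddMonoidHom.mk' (fun Y : Matrix (Fin q) (Fin p) ℝ =>
        Y * (X i).transpose) fun Y Z => Matrix.add_mul _ _ _) hcont
      simpa [Function.comp_def, f] using this
    have h0 := hf.hasSum.prod_fiberwise hrow
    rw [← h0.unique hasSum_zero]
    exact hf.hasSum
  have hsig := ((HasAntidiagonal.sigmaAntidiagonalEquivProd (A := ℕ)).hasSum_iff.2 hf0).sigma
    fun k => hasSum_fintype _
  have hcont : Continuous fun Y : Matrix (Fin q) (Fin q) ℝ => Y.trace := by fun_prop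
  have htr := hsig.map (Matrix.traceAddMonoidHom (Fin q) ℝ) hcont
  simp only [map_zero] at htr
  convert! htr using 2 with k
  have hk : Q k * (X.comp R k).transpose = ∑ x ∈ antidiagonal k, f x := by
    rw [Nat.sum_antidiagonal_eq_sum_range_succ_mk, Sys.comp, Matrix.transpose_sum, Matrix.mul_sum]
    refine sum_congr rfl fun i hi => ?_
    simp only [f]
    rw [Nat.add_sub_of_le (Nat.le_of_lt_succ (mem_range.1 hi)), Matrix.transpose_mul,
      Matrix.mul_assoc]
  rw [hk, ← sum_coe_sort]
  rfl

/-- The Lyapunov equation makes the correlation series telescope. Its first term is supplied by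
`hout` at lag 0 and by `hstate` at positive lags, and the remainder contains powers of a, which tend
to 0. -/
theorem hasSum_crossCorrelation {n q p m : ℕ} {a P : Matrix (Fin n) (Fin n) ℝ}
    {b : Matrix (Fin n) (Fin m) ℝ} {cq : Matrix (Fin q) (Fin n) ℝ} {dq : Matrix (Fin q) (Fin m) ℝ}
    {cr : Matrix (Fin p) (Fin n) ℝ} {dr : Matrix (Fin p) (Fin m) ℝ} (ha : IsStable a)
    (hP : P = a * P * a.transpose + b * b.transpose)
    (hstate : a * P * cr.transpose + b * dr.transpose = 0)
    (hout : cq * P * cr.transpose + dq * dr.transpose = 0) (i : ℕ) :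
    HasSum (fun l => ofStateSpace a b cq dq (i + l) * (ofStateSpace a b cr dr l).transpose) 0 := by
  obtain ⟨t, ht0, ht1, c, hc, hpow⟩ := ha.exists_pow_le
  obtain ⟨c₁, hc₁, hq⟩ := exists_ofStateSpace_norm_le ht0 hc hpow b cq dq
  have hgeom : Tendsto (fun N : ℕ => t ^ N) atTop (𝓝 0) :=
    tendsto_pow_atTop_nhds_zero_of_lt_one ht0.le ht1
  have hpartial : ∀ N, ∑ l ∈ range (N + 1),
      ofStateSpace a b cq dq (i + l) * (ofStateSpace a b cr dr l).transpose =
      -(cq * a ^ (i + N) * P * (a ^ N).transpose * cr.transpose) := by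
    intro N
    induction N with
    | zero =>
      cases i with
      | zero =>
        simp only [zero_add, sum_range_one, ofStateSpace, pow_zero, Matrix.transpose_one,
          Matrix.mul_one]
        exact eq_neg_of_add_eq_zero_right hout
      | succ i =>
        simp only [zero_add, sum_range_one, ofStateSpace, pow_zero, Matrix.transpose_one,
          Matrix.mul_one, add_zero, pow_succ]
        refine eq_neg_of_add_eq_zero_right ?_
        calc _ = cq * a ^ i * (a * P * cr.transpose + b * dr.transpose) := by
              simp only [Matrix.mul_add, Matrix.mul_assoc]
          _ = 0 := by rw [hstate, Matrix.mul_zero]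
    | succ N ih =>
      rw [sum_range_succ, ih, show i + (N + 1) = i + N + 1 by omega, ofStateSpace, ofStateSpace]
      conv_lhs => enter [1]; rw [hP]
      rw [pow_succ a (i + N), pow_succ a N]
      simp only [Matrix.transpose_mul, Matrix.mul_add, Matrix.add_mul, Matrix.mul_assoc]
      abel
  have hsum : Summable fun l =>
      ofStateSpace a b cq dq (i + l) * (ofStateSpace a b cr dr l).transpose := by
    refine Summable.of_norm_bounded ((ha.summable_ofStateSpace b cr dr).mul_left c₁) fun l => ?_
    refine (Matrix.frobenius_norm_mul _ _).trans ?_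
    rw [Matrix.frobenius_norm_transpose]
    gcongr
    refine (hq _).trans (mul_le_of_le_one_right hc₁ (pow_le_one₀ ht0.le ht1.le))
  rw [hsum.hasSum_iff_tendsto_nat, ← tendsto_add_atTop_iff_nat 1]
  simp only [hpartial]
  have hz : Tendsto (fun N => a ^ N) atTop (𝓝 0) :=
    squeeze_zero_norm hpow (by simpa using hgeom.const_mul c)
  have hcont : Continuous fun Y : Matrix (Fin n) (Fin n) ℝ =>
      -(cq * (a ^ i * Y) * P * Y.transpose * cr.transpose) := by fun_prop
  have := (hcont.tendsto 0).comp hz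
  simpa [Function.comp_def, pow_add] using this

end AnisoFilter

namespace AnisoFilter

namespace Plant

variable {n m p r : ℕ} (F : Plant n m p r)

/-! ### The estimation error of a Kalman-type estimator -/

/-- The estimator state is the plant state minus the error state, and the error state evolves on its
own. -/
theorem errorOp_estimator (K : Matrix (Fin n) (Fin p) ℝ) (M : Matrix (Fin r) (Fin p) ℝ) :
    F.errorOp (F.estimator K M) =
      ofStateSpace (F.A - K * F.C) (F.B - K * F.D) (F.Φ - M * F.C) (F.Ψ - M * F.D) := by
  funext k
  have h := ofStateSpace_comp (F.A - K * F.C) K (F.Φ - M * F.C) M F.F₁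
    (stateResponse F.A F.B - stateResponse (F.A - K * F.C) (F.B - K * F.D))
    (by simp [stateResponse]) (fun k => by
      simp only [Pi.sub_apply, stateResponse_succ, F₁, ofStateSpace_apply, Matrix.mul_sub,
        Matrix.sub_mul, Matrix.mul_add, Matrix.mul_assoc]
      abel) k
  rw [errorOp, Pi.sub_apply, estimator, h, F₂, F₁]
  simp only [ofStateSpace_apply, Pi.sub_apply, Matrix.mul_sub, Matrix.sub_mul, Matrix.mul_add,
    Matrix.mul_assoc]
  abel

theorem errorOp_sub_errorOp (E E' : Sys r p) :
    F.errorOp E' = F.errorOp E - (E' - E).comp F.F₁ := by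
  rw [Sys.sub_comp, errorOp, errorOp]
  abel

variable (K : Matrix (Fin n) (Fin p) ℝ) (S : Matrix (Fin m) (Fin m) ℝ)
  (L : Matrix (Fin m) (Fin n) ℝ)

/-- A system driven by the same noise as the shaping filter and sharing its state. -/
def shapedSys {q : ℕ} (c : Matrix (Fin q) (Fin n) ℝ) (d : Matrix (Fin q) (Fin m) ℝ) : Sys q m :=
  ofStateSpace (F.A - K * F.C + (F.B - K * F.D) * L) ((F.B - K * F.D) * matSqrt S) (c + d * L)
    (d * matSqrt S)

/-- Both factors have the same state trajectory, because the shaping filter feeds back L times the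
error state; the cascade therefore needs only one copy. -/
theorem ofStateSpace_comp_shapingFilter {q : ℕ} (c : Matrix (Fin q) (Fin n) ℝ)
    (d : Matrix (Fin q) (Fin m) ℝ) :
    (ofStateSpace (F.A - K * F.C) (F.B - K * F.D) c d).comp (F.shapingFilter K S L) =
      F.shapedSys K S L c d := by
  funext k
  rw [ofStateSpace_comp (x := stateResponse (F.A - K * F.C + (F.B - K * F.D) * L)
    ((F.B - K * F.D) * matSqrt S)) (h0 := rfl)]
  · simp only [shapedSys, shapingFilter, ofStateSpace_apply, Matrix.mul_add, Matrix.add_mul,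
      Matrix.mul_assoc, add_assoc]
  · intro k
    simp only [stateResponse_succ, shapingFilter, ofStateSpace_apply]
    generalize F.A - K * F.C = a
    generalize F.B - K * F.D = b
    simp only [Matrix.mul_add, Matrix.add_mul, Matrix.mul_assoc, add_assoc]

/-- The state of `x (k+1) = a x k + b u k`, `x 0 = 0`. -/
def stateOf {s : ℕ} (a : Matrix (Fin n) (Fin n) ℝ) (b : Matrix (Fin n) (Fin p) ℝ) (u : Sys p s) :
    Sys n s
  | 0 => 0
  | k + 1 => a * stateOf a b u k + b * u k

/-- The observation of the shaped noise is the response of the plant in innovations form. -/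
theorem observation_comp_shapingFilter :
    F.F₁.comp (F.shapingFilter K S L) =
      (ofStateSpace F.A K F.C 1).comp (F.shapedSys K S L F.C F.D) := by
  funext k
  rw [F₁, ofStateSpace_comp F.A K F.C 1 _ (stateOf F.A K (F.shapedSys K S L F.C F.D)) rfl
    (fun _ => rfl), ofStateSpace_comp F.A F.B F.C F.D _
    -- Plant state = error state + estimator state, the latter driven by the innovation.
    (stateResponse (F.A - K * F.C + (F.B - K * F.D) * L) ((F.B - K * F.D) * matSqrt S) +
      stateOf F.A K (F.shapedSys K S L F.C F.D))]
  · simp only [Pi.add_apply, shapedSys, shapingFilter, ofStateSpace_apply, Matrix.mul_add,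
      Matrix.add_mul, Matrix.mul_assoc, Matrix.one_mul]
    abel
  · simp [stateResponse, stateOf]
  · intro k
    simp only [Pi.add_apply, stateResponse_succ, stateOf, shapingFilter, shapedSys,
      ofStateSpace_apply, Matrix.mul_add, Matrix.add_mul, Matrix.sub_mul, Matrix.mul_assoc]
    abel

/-! ### Consequences of the Riccati equation -/

variable {F K S L} {P : Matrix (Fin n) (Fin n) ℝ}

/-- Full row rank of D makes D S Dᵀ positive definite, and the P-term only adds to it. Hence the
inverse in the gains is genuine. -/
theorem riccatiT_posDef (hD : F.D.rank = p) (hS : S.PosDef) (hP : P.PosSemidef) :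
    (F.riccatiT S L P).PosDef := by
  have hinj : Function.Injective fun v => Matrix.vecMul v F.D := by
    rw [Matrix.vecMul_injective_iff, linearIndependent_iff_card_eq_finrank_span, Set.finrank,
      ← Matrix.rank_eq_finrank_span_row, hD, Fintype.card_fin]
  have h := (hS.mul_mul_conjTranspose_same hinj).add_posSemidef
    (hP.mul_mul_conjTranspose_same (F.C + F.D * L))
  rwa [add_comm, Matrix.conjTranspose_eq_transpose_of_trivial,
    Matrix.conjTranspose_eq_transpose_of_trivial] at h

theorem riccatiK_mul_riccatiT (hT : IsUnit (F.riccatiT S L P)) :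
    F.riccatiK S L P * F.riccatiT S L P =
    (F.A + F.B * L) * P * (F.C + F.D * L).transpose + F.B * S * F.D.transpose := by
  rw [riccatiK, Matrix.mul_assoc, Matrix.nonsing_inv_mul _ ((Matrix.isUnit_iff_isUnit_det _).1 hT),
    Matrix.mul_one]

theorem riccatiM_mul_riccatiT (hT : IsUnit (F.riccatiT S L P)) :
    F.riccatiM S L P * F.riccatiT S L P =
    (F.Φ + F.Ψ * L) * P * (F.C + F.D * L).transpose + F.Ψ * S * F.D.transpose := by
  rw [riccatiM, Matrix.mul_assoc, Matrix.nonsing_inv_mul _ ((Matrix.isUnit_iff_isUnit_det _).1 hT),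
    Matrix.mul_one]

end Plant

/-- The optimal gain `K`, characterized by `K T = X`, decorrelates: the algebraic core of both the
state and the output orthogonality relations. -/
theorem closedLoop_cross_eq_zero {n m p q : ℕ} {a : Matrix (Fin q) (Fin n) ℝ}
    {b : Matrix (Fin q) (Fin m) ℝ} {c : Matrix (Fin p) (Fin n) ℝ} {d : Matrix (Fin p) (Fin m) ℝ}
    {P : Matrix (Fin n) (Fin n) ℝ} {S : Matrix (Fin m) (Fin m) ℝ} {K : Matrix (Fin q) (Fin p) ℝ}
    (hK : K * (c * P * c.transpose + d * S * d.transpose) =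
      a * P * c.transpose + b * S * d.transpose) :
    (a - K * c) * P * c.transpose + (b - K * d) * S * d.transpose = 0 := by
  rw [Matrix.mul_add] at hK
  simp only [Matrix.sub_mul, Matrix.mul_assoc] at hK ⊢
  rw [sub_add_sub_comm, ← hK, sub_self]

/-- The Riccati equation in closed-loop (Lyapunov) form. -/
theorem lyapunov_of_riccati {n m p : ℕ} {a : Matrix (Fin n) (Fin n) ℝ}
    {b : Matrix (Fin n) (Fin m) ℝ} {c : Matrix (Fin p) (Fin n) ℝ} {d : Matrix (Fin p) (Fin m) ℝ}
    {P : Matrix (Fin n) (Fin n) ℝ} {S : Matrix (Fin m) (Fin m) ℝ} {K : Matrix (Fin n) (Fin p) ℝ}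
    (hPs : P.transpose = P) (hSs : S.transpose = S)
    (hK : K * (c * P * c.transpose + d * S * d.transpose) =
      a * P * c.transpose + b * S * d.transpose)
    (hP : P = a * P * a.transpose + b * S * b.transpose -
      K * (c * P * c.transpose + d * S * d.transpose) * K.transpose) :
    P = (a - K * c) * P * (a - K * c).transpose + (b - K * d) * S * (b - K * d).transpose := by
  have h0 := closedLoop_cross_eq_zero hK
  have h1 : c * P * (a - K * c).transpose + d * S * (b - K * d).transpose = 0 := by
    have := congrArg Matrix.transpose h0
    simpa only [Matrix.transpose_add, Matrix.transpose_mul, Matrix.transpose_transpose, hPs, hSs,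
      Matrix.transpose_zero, Matrix.mul_assoc] using this
  have h2 : (a - K * c) * P * (a - K * c).transpose + (b - K * d) * S * (b - K * d).transpose =
      (a * P * a.transpose + b * S * b.transpose -
        (a * P * c.transpose + b * S * d.transpose) * K.transpose) -
      K * (c * P * (a - K * c).transpose + d * S * (b - K * d).transpose) := by
    simp only [Matrix.sub_mul, Matrix.mul_sub, Matrix.add_mul, Matrix.mul_add,
      Matrix.transpose_sub, Matrix.transpose_mul, Matrix.mul_assoc]
    abel
  rw [h2, h1, Matrix.mul_zero, sub_zero, ← hK]
  exact hP

end AnisoFilter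

end

/-! ### Optimality of the estimator -/

open AnisoFilter in
theorem lemma3 {n m p r : ℕ} (F : AnisoFilter.Plant n m p r)
    (hA : AnisoFilter.IsStable F.A) (hD : F.D.rank = p)
    (S : Matrix (Fin m) (Fin m) ℝ) (hS : S.PosDef)
    (L : Matrix (Fin m) (Fin n) ℝ)
    (P : Matrix (Fin n) (Fin n) ℝ) (hP : F.IsAdmissibleSolution S L P)
    (K : Matrix (Fin n) (Fin p) ℝ) (hK : K = F.riccatiK S L P)
    (M : Matrix (Fin r) (Fin p) ℝ) (hM : M = F.riccatiM S L P)
    (hKs : K ∈ F.stabGains) :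
    (F.shapingFilter K S L).IsH2 ∧
      F.IsMeanSquareOptimal (F.estimator K M) (F.shapingFilter K S L) := by
  obtain ⟨hPpsd, hric, hL⟩ := hP
  rw [← hK] at hL
  have hcl : IsStable (F.A - K * F.C + (F.B - K * F.D) * L) := hL
  have hKs' : IsStable (F.A - K * F.C) := hKs
  have hT := (Plant.riccatiT_posDef (L := L) hD hS hPpsd).isUnit
  have hKT := Plant.riccatiK_mul_riccatiT hT
  have hMT := Plant.riccatiM_mul_riccatiT hT
  rw [Plant.IsRiccatiSolution] at hric
  rw [← hK] at hKT hric
  rw [← hM] at hMT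
  rw [Plant.riccatiT] at hKT hMT hric
  have hsplit : F.A - K * F.C + (F.B - K * F.D) * L = F.A + F.B * L - K * (F.C + F.D * L) := by
    simp only [Matrix.sub_mul, Matrix.mul_add, Matrix.mul_assoc]
    abel
  have hsplit' : F.Φ - M * F.C + (F.Ψ - M * F.D) * L = F.Φ + F.Ψ * L - M * (F.C + F.D * L) := by
    simp only [Matrix.sub_mul, Matrix.mul_add, Matrix.mul_assoc]
    abel
  have hsqrt := matSqrt_mul_transpose hS.posSemidef
  have hnoise : ∀ {q q' : ℕ} (b : Matrix (Fin q) (Fin m) ℝ) (d : Matrix (Fin q') (Fin m) ℝ),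
      b * matSqrt S * (d * matSqrt S).transpose = b * S * d.transpose := fun b d => by
    rw [Matrix.transpose_mul, Matrix.mul_assoc, ← Matrix.mul_assoc (matSqrt S), hsqrt,
      ← Matrix.mul_assoc]
  have hPs : P.transpose = P := by
    simpa [Matrix.conjTranspose_eq_transpose_of_trivial] using hPpsd.isHermitian.eq
  have hSs : S.transpose = S := by
    simpa [Matrix.conjTranspose_eq_transpose_of_trivial] using hS.isHermitian.eq
  have hcorr := hasSum_crossCorrelation (P := P) (b := (F.B - K * F.D) * matSqrt S)
    (cq := F.Φ - M * F.C + (F.Ψ - M * F.D) * L) (dq := (F.Ψ - M * F.D) * matSqrt S)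
    (cr := F.C + F.D * L) (dr := F.D * matSqrt S) hcl
    (by rw [hnoise, hsplit]; exact lyapunov_of_riccati hPs hSs hKT hric)
    (by rw [hnoise, hsplit]; exact closedLoop_cross_eq_zero hKT)
    (by rw [hnoise, hsplit']; exact closedLoop_cross_eq_zero hMT)
  have hE : (F.estimator K M).AnalyticOnDisc :=
    Sys.analyticOnDisc_of_summable (hKs'.summable_ofStateSpace _ _ _)
  refine ⟨hcl.isH2_ofStateSpace _ _ _, ⟨hE, ?_⟩, fun E' hE' => ?_⟩
  · rw [F.errorOp_estimator]
    exact hKs'.isHInf_ofStateSpace _ _ _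
  have hQ : (F.errorOp (F.estimator K M)).comp (F.shapingFilter K S L) =
      F.shapedSys K S L (F.Φ - M * F.C) (F.Ψ - M * F.D) := by
    rw [F.errorOp_estimator, F.ofStateSpace_comp_shapingFilter]
  -- Brings the competitor's error to the form Q - X R, with R the innovation and X causal.
  rw [F.errorOp_sub_errorOp (F.estimator K M) E', Sys.sub_comp, Sys.comp_assoc,
    F.observation_comp_shapingFilter, ← Sys.comp_assoc, hQ]
  obtain ⟨t, ht0, ht1, c, hc, hpow⟩ := hcl.exists_pow_le
  obtain ⟨c₁, hc₁, hQt⟩ := exists_ofStateSpace_norm_le ht0 hc hpow ((F.B - K * F.D) * matSqrt S)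
    (F.Φ - M * F.C + (F.Ψ - M * F.D) * L) ((F.Ψ - M * F.D) * matSqrt S)
  obtain ⟨c₂, -, hRt⟩ := exists_ofStateSpace_norm_le ht0 hc hpow ((F.B - K * F.D) * matSqrt S)
    (F.C + F.D * L) (F.D * matSqrt S)
  refine Sys.h2Norm_le_of_orthogonal (hcl.summable_ofStateSpace _ _ _)
    (hasSum_trace_comp_eq_zero ht0 ht1 hc₁ hQt hRt ?_ hcorr)
  -- Both factors of X are analytic in the disc: E' - E because both estimators are, the innovations
  -- form because A is stable.
  exact Sys.summable_comp ht0.le ((hE'.1.sub hE).summable_norm ht0.le ht1)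
    ((Sys.analyticOnDisc_of_summable (hA.summable_ofStateSpace _ _ _)).summable_norm ht0.le ht1)
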